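/- For $\nu>-1$ let $J_\nu(x)=\sum_{n\ge 0}\frac{(-1)^n}{n!\,\Gamma(n+\nu+1)}\left(\frac{x}{2}\right)^{2n+\nu}$ ($x>0$) be the Bessel function of the first kind, let $j_{\nu,1}$ be its first positive zero, and let $\mathcal{J}_\nu$ be the normalized Bessel function $\mathcal{J}_\nu(x)=2^\nu\Gamma(\nu+1)x^{-\nu}J_\nu(x)=\sum_{n\ge 0}\frac{(-1)^n\,\Gamma(\nu+1)}{n!\,\Gamma(n+\nu+1)}\left(\frac{x}{2}\right)^{2n}$, defined for all $x\in\mathbb{R}$ by the last series. Theorem 3. Let $\nu>-1$. Then $j_{\nu,1}$ exists, and for all real $x$ with $|x|<j_{\nu,1}$ we have $\mathcal{J}_\nu(x)>0$, $\mathcal{J}_{\nu+1}(x)>0$ and $$\left(\frac{j_{\nu,1}^2}{j_{\nu,1}^2-x^2}\right)^{\epsilon_\nu}\le\frac{\left(\mathcal{J}_{\nu+1}(x)\right)^{\frac{\nu+2}{\nu+1}}}{\mathcal{J}_\nu(x)}\le\left(\frac{j_{\nu,1}^2}{j_{\nu,1}^2-x^2}\right)^{\varepsilon_\nu}$$ with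 $\epsilon_\nu=0$ and $\varepsilon_\nu=1$, that is, $$1\le\frac{\left(\mathcal{J}_{\nu+1}(x)\right)^{\frac{\nu+2}{\nu+1}}}{\mathcal{J}_\nu(x)}\le\frac{j_{\nu,1}^2}{j_{\nu,1}^2-x^2}.$$ These constants are best possible: $\epsilon_\nu=0$ is the largest real exponent for which the left-hand inequality holds for all $|x|<j_{\nu,1}$, and $\varepsilon_\nu=1$ is the smallest real exponent for which the right-hand inequality holds for all $|x|<j_{\nu,1}$. -/

import Mathlib

noncomputable section

/-- The Bessel function of the first kind of real order `ν`, for a positive real argument `x`: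
`J_ν(x) = ∑_{n ≥ 0} (-1)^n / (n! Γ(n + ν + 1)) (x / 2)^(2n + ν)`. -/
def besselJ (ν x : ℝ) : ℝ :=
  ∑' n : ℕ, (-1) ^ n / ((n.factorial : ℝ) * Real.Gamma (n + ν + 1)) * (x / 2) ^ (2 * (n : ℝ) + ν)

/-- The normalized Bessel function of the first kind,
`𝒥_ν(x) = 2^ν Γ(ν + 1) x^(-ν) J_ν(x)`, extended to an even function on the whole real line
by its power series `∑_{n ≥ 0} (-1)^n Γ(ν + 1) / (n! Γ(n + ν + 1)) (x / 2)^(2n)`. -/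
def normBesselJ (ν x : ℝ) : ℝ :=
  ∑' n : ℕ, (-1) ^ n * Real.Gamma (ν + 1) / ((n.factorial : ℝ) * Real.Gamma (n + ν + 1))
    * (x / 2) ^ (2 * n)

/-- The set of positive zeros of `J_ν`. -/
def besselJPosZeros (ν : ℝ) : Set ℝ := {x : ℝ | 0 < x ∧ besselJ ν x = 0}

/-- The first positive zero `j_{ν,1}` of `J_ν`. -/
def besselJFirstZero (ν : ℝ) : ℝ := sInf (besselJPosZeros ν)

/-- For `x > 0` the normalized function is `2^ν Γ(ν + 1) x^(-ν) J_ν(x)`. -/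
theorem normBesselJ_eq_of_pos (ν x : ℝ) (hx : 0 < x) :
    normBesselJ ν x = 2 ^ ν * Real.Gamma (ν + 1) * x ^ (-ν) * besselJ ν x := by
  unfold normBesselJ besselJ
  rw [← tsum_mul_left]
  congr 1
  funext n
  have h2 : (0 : ℝ) < x / 2 := by positivity
  have hpow : (x / 2) ^ (2 * (n : ℝ) + ν) = (x / 2) ^ (2 * n) * (x / 2) ^ ν := by
    rw [Real.rpow_add h2]
    congr 1
    rw [← Real.rpow_natCast]
    push_cast
    rfl
  have hone : (2 : ℝ) ^ ν * x ^ (-ν) * (x / 2) ^ ν = 1 := by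
    have h3 : (2 : ℝ) ^ ν ≠ 0 := by positivity
    have h4 : x ^ ν ≠ 0 := by positivity
    rw [Real.div_rpow hx.le (by norm_num), Real.rpow_neg hx.le]
    field_simp
  rw [hpow]
  linear_combination (-((-1) ^ n * Real.Gamma (ν + 1) /
    ((n.factorial : ℝ) * Real.Gamma (n + ν + 1)) * (x / 2) ^ (2 * n))) * hone

end

/-! Put `a = ν + 1`, `t = x ^ 2 / 4` and write F_a for `besselSeries a`. Then 𝒥_ν(x) = F_a(t), the
exponent is (a+1)/a, and with j² = 4τ the comparison function is τ/(τ-t). Everything rests on F_a' =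
-F_{a+1}/a and the contiguous relation F_{a+1} - F_a = t F_{a+2}/(a(a+1)).

These give positivity of the higher parameters up to τ and the Turán inequality F_a F_{a+2} ≤
F_{a+1}² (`besselSeries_turan`). Turán at a is the monotonicity of F_{a+1}^((a+1)/a)/F_a, hence the
lower bound. Turán at a+1 makes F_{a+2}/F_{a+1} increase (`besselSeries_ratio_mono`), which yields
both the existence of τ and F_a/F_{a+1} ≥ 1 - t/τ, hence the upper bound.

Sharpness is read off at the endpoints: the quotient is stationary at t = 0, and F_a vanishes at
least linearly at τ while F_{a+1}(τ) > 0. -/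

/-! ### Coefficients and convergence -/

/-- The series `∑ (-1)^n Γ(a) / (n! Γ(n + a)) t^n`, i.e. the confluent hypergeometric limit function
`₀F₁(; a; -t)`. -/
noncomputable def besselSeries (a t : ℝ) : ℝ :=
  ∑' n : ℕ, (-1) ^ n * Real.Gamma a / ((n.factorial : ℝ) * Real.Gamma (n + a)) * t ^ n

/-- The coefficients of `besselSeries`. -/
noncomputable def besselCoeff (a : ℝ) (n : ℕ) : ℝ :=
  (-1) ^ n * Real.Gamma a / ((n.factorial : ℝ) * Real.Gamma (n + a))

theorem besselSeries_eq_tsum (a t : ℝ) :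
    besselSeries a t = ∑' n : ℕ, besselCoeff a n * t ^ n := rfl

theorem normBesselJ_eq_besselSeries (ν x : ℝ) :
    normBesselJ ν x = besselSeries (ν + 1) (x ^ 2 / 4) := by
  unfold normBesselJ besselSeries
  congr 1
  funext n
  rw [pow_mul, div_pow, add_assoc]
  norm_num

theorem besselCoeff_zero {a : ℝ} (ha : 0 < a) : besselCoeff a 0 = 1 := by
  have := (Real.Gamma_pos_of_pos ha).ne'
  simp [besselCoeff, this]

theorem besselCoeff_succ_mul {a : ℝ} (ha : 0 < a) (n : ℕ) :
    besselCoeff a (n + 1) * (n + 1) = -(1 / a) * besselCoeff (a + 1) n := by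
  have h1 : (0 : ℝ) < Real.Gamma (n + (a + 1)) := Real.Gamma_pos_of_pos (by positivity)
  have h2 : (0 : ℝ) < n.factorial := by positivity
  have h3 : ((n + 1 : ℕ) : ℝ) + a = n + (a + 1) := by push_cast; ring
  have h4 : (n : ℝ) + 1 ≠ 0 := by positivity
  unfold besselCoeff
  rw [h3, Real.Gamma_add_one ha.ne', Nat.factorial_succ, pow_succ]
  push_cast
  field_simp

theorem besselCoeff_add_one_sub {a : ℝ} (ha : 0 < a) (n : ℕ) :
    besselCoeff (a + 1) (n + 1) - besselCoeff a (n + 1) =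
      1 / (a * (a + 1)) * besselCoeff (a + 2) n := by
  have h1 : (0 : ℝ) < Real.Gamma (n + (a + 1)) := Real.Gamma_pos_of_pos (by positivity)
  have h2 : (0 : ℝ) < n.factorial := by positivity
  have h3 : ((n + 1 : ℕ) : ℝ) + a = n + (a + 1) := by push_cast; ring
  have h3' : ((n + 1 : ℕ) : ℝ) + (a + 1) = n + (a + 1) + 1 := by push_cast; ring
  have h3'' : (n : ℝ) + (a + 2) = n + (a + 1) + 1 := by ring
  have h4 : (n : ℝ) + 1 ≠ 0 := by positivity
  have h5 : (n : ℝ) + (a + 1) ≠ 0 := by positivity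
  have h6 : a + 1 ≠ 0 := by positivity
  have h7 : a + 2 = a + 1 + 1 := by ring
  unfold besselCoeff
  rw [h3, h3', h3'', Real.Gamma_add_one h5, h7, Real.Gamma_add_one h6, Real.Gamma_add_one ha.ne',
    Nat.factorial_succ, pow_succ]
  push_cast
  field_simp
  ring

/-- Γ need not be monotone near `a` when `a` is small, so growth is only used from `a + 1` on, where
each recursion factor is at least 1. The summand 1 of the constant covers `n = 0`, and 1/a =
Γ(a)/Γ(a+1) covers `n ≥ 1`. -/
theorem abs_besselCoeff_le {a : ℝ} (ha : 0 < a) (n : ℕ) :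
    |besselCoeff a n| ≤ (1 + 1 / a) / n.factorial := by
  have key : ∀ m : ℕ, Real.Gamma (a + 1) ≤ Real.Gamma (m + (a + 1)) := by
    intro m
    induction m with
    | zero => simp
    | succ k ih =>
      have h5 : (k : ℝ) + (a + 1) ≠ 0 := by positivity
      have h3 : ((k + 1 : ℕ) : ℝ) + (a + 1) = k + (a + 1) + 1 := by push_cast; ring
      have hpos : (0 : ℝ) < Real.Gamma (k + (a + 1)) := Real.Gamma_pos_of_pos (by positivity)
      have hk : (0 : ℝ) ≤ k := by positivity
      rw [h3, Real.Gamma_add_one h5]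
      nlinarith
  have hG := Real.Gamma_pos_of_pos ha
  have hGn : (0 : ℝ) < Real.Gamma (n + a) := Real.Gamma_pos_of_pos (by positivity)
  have hf : (0 : ℝ) < n.factorial := by positivity
  have habs : |besselCoeff a n| = Real.Gamma a / Real.Gamma (n + a) / n.factorial := by
    unfold besselCoeff
    rw [abs_div, abs_mul, abs_pow, abs_neg, abs_one, one_pow, one_mul, abs_of_pos hG,
      abs_of_pos (by positivity)]
    field_simp
  rw [habs]
  gcongr
  rw [div_le_iff₀ hGn]
  have ha' : 0 < 1 / a := by positivity
  cases n with
  | zero =>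
    simp only [Nat.cast_zero, zero_add]
    nlinarith [mul_pos ha' hG]
  | succ k =>
    have h3 : ((k + 1 : ℕ) : ℝ) + a = k + (a + 1) := by push_cast; ring
    rw [h3] at hGn ⊢
    have h := key k
    rw [Real.Gamma_add_one ha.ne'] at h
    have : Real.Gamma a ≤ 1 / a * Real.Gamma (k + (a + 1)) := by
      rw [one_div, inv_mul_eq_div, le_div_iff₀ ha]
      linarith
    linarith

theorem norm_besselCoeff_mul_pow_le {a t R : ℝ} (ha : 0 < a) (ht : |t| ≤ R) (n : ℕ) :
    ‖besselCoeff a n * t ^ n‖ ≤ (1 + 1 / a) * (R ^ n / n.factorial) := by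
  rw [Real.norm_eq_abs, abs_mul, abs_pow]
  calc |besselCoeff a n| * |t| ^ n ≤ (1 + 1 / a) / n.factorial * R ^ n := by
        gcongr
        exact abs_besselCoeff_le ha n
    _ = _ := by ring

theorem summable_besselSeries_bound (c R : ℝ) :
    Summable fun n : ℕ => c * (R ^ n / n.factorial) :=
  (Real.summable_pow_div_factorial R).mul_left _

theorem summable_besselSeries {a : ℝ} (ha : 0 < a) (t : ℝ) :
    Summable fun n : ℕ => besselCoeff a n * t ^ n :=
  Summable.of_norm_bounded (summable_besselSeries_bound _ |t|)
    fun n => norm_besselCoeff_mul_pow_le ha le_rfl n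

theorem besselSeries_zero {a : ℝ} (ha : 0 < a) : besselSeries a 0 = 1 := by
  rw [besselSeries_eq_tsum, tsum_eq_single 0 (fun n hn => by simp [hn]), besselCoeff_zero ha]
  simp

theorem besselSeries_eq_one_add {a : ℝ} (ha : 0 < a) (t : ℝ) :
    besselSeries a t = 1 + ∑' n : ℕ, besselCoeff a (n + 1) * t ^ (n + 1) := by
  rw [besselSeries_eq_tsum, (summable_besselSeries ha t).tsum_eq_zero_add, besselCoeff_zero ha]
  simp

/-! ### Derivative and contiguous relation -/

theorem hasDerivAt_besselSeries {a : ℝ} (ha : 0 < a) (t : ℝ) :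
    HasDerivAt (besselSeries a) (-(besselSeries (a + 1) t) / a) t := by
  have ha1 : 0 < a + 1 := by positivity
  have hmem : t ∈ Metric.ball (0 : ℝ) (|t| + 1) := by simp
  have h := hasDerivAt_tsum_of_isPreconnected (𝕜 := ℝ)
    (g := fun (n : ℕ) y => besselCoeff a (n + 1) * y ^ (n + 1))
    (g' := fun (n : ℕ) y => -(1 / a) * (besselCoeff (a + 1) n * y ^ n))
    (u := fun n : ℕ => 1 / a * ((1 + 1 / (a + 1)) * ((|t| + 1) ^ n / n.factorial)))
    (t := Metric.ball (0 : ℝ) (|t| + 1)) (y₀ := t) (y := t)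
    ((summable_besselSeries_bound _ _).mul_left _) Metric.isOpen_ball
    (convex_ball _ _).isPreconnected ?_ ?_ hmem
    ((summable_nat_add_iff 1).2 (summable_besselSeries ha t)) hmem
  · have h2 := h.const_add 1
    rw [tsum_mul_left, ← besselSeries_eq_tsum] at h2
    rw [show besselSeries a = fun y => 1 + ∑' n : ℕ, besselCoeff a (n + 1) * y ^ (n + 1) from
      funext (besselSeries_eq_one_add ha)]
    exact h2.congr_deriv (by ring)
  · intro n y _
    have := (hasDerivAt_pow (n + 1) y).const_mul (besselCoeff a (n + 1))
    refine this.congr_deriv ?_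
    push_cast
    rw [← mul_assoc, ← mul_assoc, besselCoeff_succ_mul ha]
  · intro n y hy
    rw [norm_mul, Real.norm_eq_abs, abs_neg, abs_of_pos (by positivity)]
    have hy' : |y| ≤ |t| + 1 := by
      have := mem_ball_zero_iff.1 hy
      rw [Real.norm_eq_abs] at this
      exact this.le
    gcongr
    exact norm_besselCoeff_mul_pow_le ha1 hy' n

theorem continuous_besselSeries {a : ℝ} (ha : 0 < a) : Continuous (besselSeries a) :=
  continuous_iff_continuousAt.2 fun t => (hasDerivAt_besselSeries ha t).continuousAt

/-- The contiguous relation. -/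
theorem besselSeries_add_one_sub {a : ℝ} (ha : 0 < a) (t : ℝ) :
    besselSeries (a + 1) t - besselSeries a t = t * besselSeries (a + 2) t / (a * (a + 1)) := by
  have ha1 : 0 < a + 1 := by positivity
  rw [besselSeries_eq_one_add ha, besselSeries_eq_one_add ha1, add_sub_add_left_eq_sub,
    ← ((summable_nat_add_iff 1).2 (summable_besselSeries ha1 t)).tsum_sub
      ((summable_nat_add_iff 1).2 (summable_besselSeries ha t)),
    besselSeries_eq_tsum, mul_div_right_comm, ← tsum_mul_left]
  congr 1
  funext n
  rw [← sub_mul, besselCoeff_add_one_sub ha]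
  ring

/-! ### Positivity, Turán inequality, monotone ratio -/

/-- Positivity on a half-open interval from `0` passes to the next parameter, on the closed
interval. -/
theorem besselSeries_add_one_pos {a T : ℝ} (ha : 0 < a)
    (h : ∀ t, 0 ≤ t → t < T → 0 < besselSeries a t) {t : ℝ} (ht0 : 0 ≤ t) (htT : t ≤ T) :
    0 < besselSeries (a + 1) t := by
  have ha1 : 0 < a + 1 := by positivity
  rcases ht0.eq_or_lt with rfl | ht
  · rw [besselSeries_zero ha1]
    exact one_pos
  -- The contiguous relation turns the derivative of s^a F_{a+1} into a s^(a-1) F_a. The weight s^a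
  -- makes the function start from 0.
  have hmono : StrictMonoOn (fun s : ℝ => s ^ a * besselSeries (a + 1) s) (Set.Icc 0 T) := by
    refine strictMonoOn_of_hasDerivWithinAt_pos (convex_Icc 0 T)
      (f' := fun s => a * s ^ (a - 1) * besselSeries a s) ?_ ?_ ?_
    · exact ((Real.continuous_rpow_const ha.le).mul (continuous_besselSeries ha1)).continuousOn
    · intro s hs
      rw [interior_Icc] at hs
      have hs0 := hs.1
      have h1 := (Real.hasDerivAt_rpow_const (p := a) (Or.inl hs0.ne')).mul
        (hasDerivAt_besselSeries ha1 s)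
      refine (h1.congr_deriv ?_).hasDerivWithinAt
      have h2 := besselSeries_add_one_sub ha s
      have h3 : s ^ a = s ^ (a - 1) * s := by
        rw [← Real.rpow_add_one hs0.ne']
        simp
      have h4 : a + 1 + 1 = a + 2 := by ring
      rw [h3, h4]
      field_simp at h2 ⊢
      linear_combination h2
    · intro s hs
      rw [interior_Icc] at hs
      have hs0 := hs.1
      have := h s hs.1.le hs.2
      positivity
  have h0 := hmono ⟨le_rfl, ht0.trans htT⟩ ⟨ht0, htT⟩ ht
  simp only [Real.zero_rpow ha.ne', zero_mul] at h0
  exact pos_of_mul_pos_right h0 (by positivity)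

/-- A Turán type inequality. -/
theorem besselSeries_turan {a T : ℝ} (ha : 0 < a)
    (h1 : ∀ t, 0 ≤ t → t ≤ T → 0 < besselSeries (a + 1) t)
    (h2 : ∀ t, 0 ≤ t → t ≤ T → 0 < besselSeries (a + 2) t) {t : ℝ} (ht0 : 0 ≤ t) (htT : t ≤ T) :
    besselSeries a t * besselSeries (a + 2) t ≤ besselSeries (a + 1) t ^ 2 := by
  have ha1 : 0 < a + 1 := by positivity
  have ha2 : 0 < a + 2 := by positivity
  rcases ht0.eq_or_lt with rfl | ht
  · rw [besselSeries_zero ha, besselSeries_zero ha1, besselSeries_zero ha2]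
    norm_num
  -- With the weight s^(a+1) the derivative of the Turán difference collapses to a positive multiple
  -- of F_{a+1} F_{a+2}, and the value at 0 is 0.
  have hmono : MonotoneOn (fun s : ℝ => s ^ (a + 1) *
      (besselSeries (a + 1) s ^ 2 - besselSeries a s * besselSeries (a + 2) s)) (Set.Icc 0 T) := by
    refine monotoneOn_of_hasDerivWithinAt_nonneg (convex_Icc 0 T)
      (f' := fun s => 2 * s ^ (a + 1) * besselSeries (a + 1) s * besselSeries (a + 2) s /
        (a * (a + 1))) ?_ ?_ ?_
    · exact ((Real.continuous_rpow_const ha1.le).mul (((continuous_besselSeries ha1).pow 2).sub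
        ((continuous_besselSeries ha).mul (continuous_besselSeries ha2)))).continuousOn
    · intro s hs
      rw [interior_Icc] at hs
      have hs0 := hs.1
      have hd := (Real.hasDerivAt_rpow_const (p := a + 1) (Or.inl hs0.ne')).mul
        (((hasDerivAt_besselSeries ha1 s).pow 2).sub
          ((hasDerivAt_besselSeries ha s).mul (hasDerivAt_besselSeries ha2 s)))
      refine (hd.congr_deriv ?_).hasDerivWithinAt
      have e1 := besselSeries_add_one_sub ha s
      have e2 := besselSeries_add_one_sub ha1 s
      have h3 : s ^ (a + 1) = s ^ a * s := Real.rpow_add_one hs0.ne' a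
      have h4 : a + 1 + 1 = a + 2 := by ring
      have h5 : a + 1 + 2 = a + 2 + 1 := by ring
      have h6 : a + 1 - 1 = a := by ring
      rw [h4, h5] at e2
      simp only [Pi.sub_apply, Pi.mul_apply, Pi.pow_apply]
      rw [h3, h4, h6]
      have e2' : s * besselSeries (a + 2 + 1) s / (a + 2) =
          (a + 1) * (besselSeries (a + 2) s - besselSeries (a + 1) s) := by
        rw [e2]
        field_simp
      -- `e1'`, `ea` and `eb` are one contiguous relation, scaled to each denominator that occurs in
      -- the derivative.
      have e1' : s * besselSeries (a + 2) s / (a * (a + 1)) =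
          besselSeries (a + 1) s - besselSeries a s := e1.symm
      have ea : s * besselSeries (a + 2) s / a =
          (a + 1) * (besselSeries (a + 1) s - besselSeries a s) := by
        rw [e1]
        field_simp
      have eb : s * besselSeries (a + 2) s / (a + 1) =
          a * (besselSeries (a + 1) s - besselSeries a s) := by
        rw [e1]
        field_simp
      push_cast
      linear_combination (s ^ a * besselSeries a s) * e2' - 2 * (s ^ a * besselSeries (a + 1) s) * e1'
        + (s ^ a * besselSeries (a + 1) s) * ea - 2 * (s ^ a * besselSeries (a + 1) s) * eb
    · intro s hs
      rw [interior_Icc] at hs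
      have hs0 := hs.1
      have := h1 s hs.1.le hs.2.le
      have := h2 s hs.1.le hs.2.le
      positivity
  have h0 := hmono ⟨le_rfl, ht0.trans htT⟩ ⟨ht0, htT⟩ ht0
  simp only [Real.zero_rpow ha1.ne', zero_mul] at h0
  have := nonneg_of_mul_nonneg_right h0 (by positivity)
  linarith

/-- The sign of the derivative comes from the Turán inequality with parameter `a + 1`. -/
theorem besselSeries_ratio_mono {a T s t : ℝ} (ha : 0 < a)
    (h : ∀ t, 0 ≤ t → t < T → 0 < besselSeries a t) (hs : 0 ≤ s) (hst : s ≤ t) (ht : t ≤ T) :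
    besselSeries (a + 2) s / besselSeries (a + 1) s ≤
      besselSeries (a + 2) t / besselSeries (a + 1) t := by
  have ha1 : 0 < a + 1 := by positivity
  have ha2 : 0 < a + 2 := by positivity
  have h4 : a + 1 + 1 = a + 2 := by ring
  have h5 : a + 1 + 2 = a + 2 + 1 := by ring
  have p1 : ∀ t, 0 ≤ t → t ≤ T → 0 < besselSeries (a + 1) t :=
    fun t h0 hT => besselSeries_add_one_pos ha h h0 hT
  have p2 : ∀ t, 0 ≤ t → t ≤ T → 0 < besselSeries (a + 2) t := fun t h0 hT =>
    h4 ▸ besselSeries_add_one_pos ha1 (fun t h0 hT => p1 t h0 hT.le) h0 hT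
  have p3 : ∀ t, 0 ≤ t → t ≤ T → 0 < besselSeries (a + 2 + 1) t := fun t h0 hT =>
    besselSeries_add_one_pos ha2 (fun t h0 hT => p2 t h0 hT.le) h0 hT
  have hmono : MonotoneOn (fun s : ℝ => besselSeries (a + 2) s / besselSeries (a + 1) s)
      (Set.Icc 0 T) := by
    refine monotoneOn_of_hasDerivWithinAt_nonneg (convex_Icc 0 T)
      (f' := fun s => (-(besselSeries (a + 2 + 1) s) / (a + 2) * besselSeries (a + 1) s -
        besselSeries (a + 2) s * (-(besselSeries (a + 2) s) / (a + 1))) /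
          besselSeries (a + 1) s ^ 2) ?_ ?_ ?_
    · exact (continuous_besselSeries ha2).continuousOn.div (continuous_besselSeries ha1).continuousOn
        fun s hs => (p1 s hs.1 hs.2).ne'
    · intro s hs
      have hs' := interior_subset hs
      have hd := (hasDerivAt_besselSeries ha2 s).div (hasDerivAt_besselSeries ha1 s)
        (p1 s hs'.1 hs'.2).ne'
      rw [h4] at hd
      exact hd.hasDerivWithinAt
    · intro s hs
      have hs' := interior_subset hs
      have hT := besselSeries_turan (T := T) ha1 (fun t h0 h => h4 ▸ p2 t h0 h)
        (fun t h0 h => h5 ▸ p3 t h0 h) hs'.1 hs'.2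
      rw [h4, h5] at hT
      have q2 := p2 s hs'.1 hs'.2
      refine div_nonneg ?_ (sq_nonneg _)
      -- Splitting 1/(a+1) = 1/(a+2) + 1/((a+1)(a+2)) isolates the Turán difference and leaves a
      -- square.
      have e : -(besselSeries (a + 2 + 1) s) / (a + 2) * besselSeries (a + 1) s -
          besselSeries (a + 2) s * (-(besselSeries (a + 2) s) / (a + 1)) =
          (besselSeries (a + 2) s ^ 2 - besselSeries (a + 1) s * besselSeries (a + 2 + 1) s) /
            (a + 2) + besselSeries (a + 2) s ^ 2 / ((a + 1) * (a + 2)) := by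
        field_simp
        ring
      rw [e]
      have := sub_nonneg.2 hT
      positivity
  exact hmono ⟨hs, hst.trans ht⟩ ⟨hs.trans hst, ht⟩ hst

/-! ### Existence of the first zero -/

/-- If F_a stayed positive, the increasing ratio F_{a+2}/F_{a+1} would be at least its value 1 at 0,
and the contiguous relation would then force F_a ≤ 0 at a suitable point. -/
theorem exists_besselSeries_nonpos {a : ℝ} (ha : 0 < a) : ∃ t, 0 ≤ t ∧ besselSeries a t ≤ 0 := by
  by_contra! h
  have ha1 : 0 < a + 1 := by positivity
  have ha2 : 0 < a + 2 := by positivity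
  -- At this point the contiguous relation reads F_{a+1} - F_a = F_{a+2}.
  set T := a * (a + 1) with hT
  have hT0 : 0 < T := by positivity
  have h1 := besselSeries_ratio_mono (T := T) ha (fun t h0 _ => h t h0) le_rfl hT0.le le_rfl
  have hpos := besselSeries_add_one_pos (T := T) ha (fun t h0 _ => h t h0) hT0.le le_rfl
  rw [besselSeries_zero ha1, besselSeries_zero ha2, div_one, le_div_iff₀ hpos] at h1
  have h2 := besselSeries_add_one_sub ha T
  rw [← hT, mul_div_cancel_left₀ _ hT0.ne'] at h2
  have h3 := h T hT0.le
  linarith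

theorem exists_besselSeries_first_zero {a : ℝ} (ha : 0 < a) :
    ∃ τ, 0 < τ ∧ besselSeries a τ = 0 ∧ ∀ t, 0 ≤ t → t < τ → 0 < besselSeries a t := by
  obtain ⟨u, hu0, hu⟩ := exists_besselSeries_nonpos ha
  set S : Set ℝ := Set.Ici 0 ∩ {t | besselSeries a t ≤ 0} with hS
  have hSc : IsClosed S :=
    isClosed_Ici.inter (isClosed_le (continuous_besselSeries ha) continuous_const)
  have hne : S.Nonempty := ⟨u, hu0, hu⟩
  have hbdd : BddBelow S := ⟨0, fun t ht => ht.1⟩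
  have hmem : sInf S ∈ S := hSc.csInf_mem hne hbdd
  have hlt : ∀ t, 0 ≤ t → t < sInf S → 0 < besselSeries a t := by
    intro t h0 ht
    by_contra! hle
    exact absurd (csInf_le hbdd (show t ∈ S from ⟨h0, hle⟩)) (not_le.2 ht)
  have h0 : 0 < sInf S := by
    refine lt_of_le_of_ne hmem.1 fun h => ?_
    have h2 := hmem.2
    rw [← h, Set.mem_ofPred_eq, besselSeries_zero ha] at h2
    linarith
  refine ⟨sInf S, h0, le_antisymm hmem.2 ?_, hlt⟩
  -- The infimum belongs to the closed set F_a ≤ 0; the reverse inequality is the left limit of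
  -- positive values.
  refine ge_of_tendsto (x := nhdsWithin (sInf S) (Set.Iio (sInf S)))
    (((continuous_besselSeries ha).tendsto _).mono_left nhdsWithin_le_nhds) ?_
  filter_upwards [Ioo_mem_nhdsLT h0] with t ht
  exact (hlt t ht.1.le ht.2).le

/-! ### The two bounds -/

section Bounds

variable {a τ : ℝ}

/-- The logarithmic derivative of the quotient is the Turán difference over a F_{a+1} F_a, hence
nonnegative, and the quotient is 1 at 0. -/
theorem one_le_besselSeries_rpow_div (ha : 0 < a)
    (h : ∀ t, 0 ≤ t → t < τ → 0 < besselSeries a t) {t : ℝ} (ht0 : 0 ≤ t) (ht : t < τ) :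
    1 ≤ besselSeries (a + 1) t ^ ((a + 1) / a) / besselSeries a t := by
  have ha1 : 0 < a + 1 := by positivity
  have h4 : a + 1 + 1 = a + 2 := by ring
  have p1 : ∀ t, 0 ≤ t → t ≤ τ → 0 < besselSeries (a + 1) t :=
    fun t h0 hT => besselSeries_add_one_pos ha h h0 hT
  have p2 : ∀ t, 0 ≤ t → t ≤ τ → 0 < besselSeries (a + 2) t := fun t h0 hT =>
    h4 ▸ besselSeries_add_one_pos ha1 (fun t h0 hT => p1 t h0 hT.le) h0 hT
  have hmono : MonotoneOn (fun s : ℝ => (a + 1) / a * Real.log (besselSeries (a + 1) s) -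
      Real.log (besselSeries a s)) (Set.Ico 0 τ) := by
    refine monotoneOn_of_hasDerivWithinAt_nonneg (convex_Ico 0 τ)
      (f' := fun s => (a + 1) / a * (-(besselSeries (a + 1 + 1) s) / (a + 1) /
        besselSeries (a + 1) s) - -(besselSeries (a + 1) s) / a / besselSeries a s) ?_ ?_ ?_
    · exact (((continuous_besselSeries ha1).continuousOn.log
        fun s hs => (p1 s hs.1 hs.2.le).ne').const_mul _).sub
          ((continuous_besselSeries ha).continuousOn.log fun s hs => (h s hs.1 hs.2).ne')
    · intro s hs
      have hs' := interior_subset hs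
      exact ((((hasDerivAt_besselSeries ha1 s).log (p1 s hs'.1 hs'.2.le).ne').const_mul _).sub
        ((hasDerivAt_besselSeries ha s).log (h s hs'.1 hs'.2).ne')).hasDerivWithinAt
    · intro s hs
      have hs' := interior_subset hs
      have hT := besselSeries_turan ha p1 p2 hs'.1 hs'.2.le
      have q0 := h s hs'.1 hs'.2
      have q1 := p1 s hs'.1 hs'.2.le
      have e : (a + 1) / a * (-(besselSeries (a + 1 + 1) s) / (a + 1) /
          besselSeries (a + 1) s) - -(besselSeries (a + 1) s) / a / besselSeries a s =
          (besselSeries (a + 1) s ^ 2 - besselSeries a s * besselSeries (a + 2) s) /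
            (a * besselSeries (a + 1) s * besselSeries a s) := by
        rw [h4]
        field_simp
        ring
      rw [e]
      have := sub_nonneg.2 hT
      positivity
  have h0 := hmono ⟨le_rfl, ht0.trans_lt ht⟩ ⟨ht0, ht⟩ ht0
  simp only [besselSeries_zero ha, besselSeries_zero ha1, Real.log_one, mul_zero, sub_zero] at h0
  rw [one_le_div (h t ht0 ht), ← Real.log_le_log_iff (h t ht0 ht)
    (Real.rpow_pos_of_pos (p1 t ht0 ht.le) _), Real.log_rpow (p1 t ht0 ht.le)]
  linarith

theorem besselSeries_add_one_le_one (ha : 0 < a)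
    (h : ∀ t, 0 ≤ t → t < τ → 0 < besselSeries a t) {t : ℝ} (ht0 : 0 ≤ t) (ht : t ≤ τ) :
    besselSeries (a + 1) t ≤ 1 := by
  have ha1 : 0 < a + 1 := by positivity
  have hanti : AntitoneOn (besselSeries (a + 1)) (Set.Icc 0 τ) := by
    refine antitoneOn_of_hasDerivWithinAt_nonpos (convex_Icc 0 τ)
      (continuous_besselSeries ha1).continuousOn
      (fun s _ => (hasDerivAt_besselSeries ha1 s).hasDerivWithinAt) fun s hs => ?_
    have hs' := interior_subset hs
    have := besselSeries_add_one_pos ha1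
      (fun t h0 hT => besselSeries_add_one_pos ha h h0 hT.le) hs'.1 hs'.2
    rw [neg_div, neg_nonpos]
    positivity
  exact (hanti ⟨le_rfl, ht0.trans ht⟩ ⟨ht0, ht⟩ ht0).trans_eq (besselSeries_zero ha1)

/-- Since 0 < F_{a+1} ≤ 1 and (a+1)/a ≥ 1, the power may be replaced by F_{a+1} itself. It remains
to see F_a/F_{a+1} = 1 - t/(a(a+1)) · F_{a+2}/F_{a+1} ≥ 1 - t/τ, which follows by bounding the
increasing ratio by its value at τ. -/
theorem besselSeries_rpow_div_le (ha : 0 < a) (hτ : besselSeries a τ = 0)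
    (h : ∀ t, 0 ≤ t → t < τ → 0 < besselSeries a t) {t : ℝ} (ht0 : 0 ≤ t) (ht : t < τ) :
    besselSeries (a + 1) t ^ ((a + 1) / a) / besselSeries a t ≤ τ / (τ - t) := by
  have hτ0 : 0 < τ := ht0.trans_lt ht
  have p1 := besselSeries_add_one_pos ha h ht0 ht.le
  have p1τ := besselSeries_add_one_pos ha h hτ0.le le_rfl
  have p0 := h t ht0 ht
  have hle : besselSeries (a + 1) t ^ ((a + 1) / a) ≤ besselSeries (a + 1) t :=
    Real.rpow_le_self_of_le_one p1.le (besselSeries_add_one_le_one ha h ht0 ht.le)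
      (by rw [le_div_iff₀ ha]; linarith)
  have hr := besselSeries_ratio_mono ha h ht0 ht.le le_rfl
  have e1 := besselSeries_add_one_sub ha t
  have e2 := besselSeries_add_one_sub ha τ
  rw [hτ, sub_zero] at e2
  -- As F_a(τ) = 0, the contiguous relation at τ determines the ratio there.
  have e3 : besselSeries (a + 2) τ / besselSeries (a + 1) τ = a * (a + 1) / τ := by
    rw [div_eq_div_iff p1τ.ne' hτ0.ne', e2]
    field_simp
  rw [e3, div_le_iff₀ p1] at hr
  have e4 : besselSeries (a + 1) t - besselSeries a t ≤ t / τ * besselSeries (a + 1) t := by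
    rw [e1, div_le_iff₀ (by positivity)]
    calc t * besselSeries (a + 2) t ≤ t * (a * (a + 1) / τ * besselSeries (a + 1) t) := by gcongr
      _ = _ := by ring
  have hsub := sub_pos.2 ht
  rw [div_le_div_iff₀ p0 hsub]
  calc besselSeries (a + 1) t ^ ((a + 1) / a) * (τ - t) ≤ besselSeries (a + 1) t * (τ - t) := by
        gcongr
    _ = τ * (besselSeries (a + 1) t - t / τ * besselSeries (a + 1) t) := by
        field_simp
    _ ≤ τ * besselSeries a t := by
        gcongr
        linarith

/-! ### Sharpness of the exponents -/

theorem nonpos_of_rpow_le_besselSeries (ha : 0 < a) (hτ0 : 0 < τ)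
    (h : ∀ t, 0 ≤ t → t < τ → 0 < besselSeries a t) {ε : ℝ}
    (hε : ∀ t, 0 ≤ t → t < τ →
      (τ / (τ - t)) ^ ε ≤ besselSeries (a + 1) t ^ ((a + 1) / a) / besselSeries a t) :
    ε ≤ 0 := by
  have ha1 : 0 < a + 1 := by positivity
  have ha2 : 0 < a + 1 + 1 := by positivity
  -- Up to the constant ε log τ, this is the logarithm of the quotient divided by (τ/(τ-s))^ε. The
  -- Bessel terms cancel to first order at 0, which leaves the slope -ε/τ; it must be nonnegative.
  set φ : ℝ → ℝ := fun s => (a + 1) / a * Real.log (besselSeries (a + 1) s) -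
    Real.log (besselSeries a s) + ε * Real.log (τ - s) with hφ
  have hd : HasDerivAt φ (-ε / τ) 0 := by
    have z0 := besselSeries_zero ha
    have z1 := besselSeries_zero ha1
    have h1 := (((hasDerivAt_besselSeries ha1 0).log (by simp [z1])).const_mul ((a + 1) / a)).sub
      ((hasDerivAt_besselSeries ha 0).log (by simp [z0]))
    have h2 := (((hasDerivAt_id (0 : ℝ)).const_sub τ).log (by simp [hτ0.ne'])).const_mul ε
    refine (h1.add h2).congr_deriv ?_
    rw [z0, z1, besselSeries_zero ha2]
    simp only [id, sub_zero]
    field_simp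
    ring
  have hφ0 : φ 0 = ε * Real.log τ := by
    simp [hφ, besselSeries_zero ha, besselSeries_zero ha1]
  have hge : ∀ t, 0 < t → t < τ → φ 0 ≤ φ t := by
    intro t ht0 ht
    have p0 := h t ht0.le ht
    have p1 := besselSeries_add_one_pos ha h ht0.le ht.le
    have hsub := sub_pos.2 ht
    have h1 := Real.log_le_log (by positivity) (hε t ht0.le ht)
    rw [Real.log_rpow (by positivity), Real.log_div hτ0.ne' hsub.ne',
      Real.log_div (by positivity) p0.ne', Real.log_rpow p1] at h1
    rw [hφ0]
    simp only [hφ]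
    linarith
  have hslope := (hasDerivWithinAt_iff_tendsto_slope' (s := Set.Ioi (0 : ℝ)) (by simp)).1
    hd.hasDerivWithinAt
  have hlim : 0 ≤ -ε / τ := by
    refine ge_of_tendsto hslope ?_
    filter_upwards [Ioo_mem_nhdsGT hτ0] with t ht
    rw [slope_def_field]
    have := hge t ht.1 ht.2
    exact div_nonneg (by linarith) (by linarith [ht.1])
  rw [le_div_iff₀ hτ0] at hlim
  linarith

/-- If ε < 1, the bound reads F_{a+1}^((a+1)/a) ≤ τ^ε · (F_a(t)/(τ-t)) · (τ-t)^(1-ε). As t → τ from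
the left the difference quotient converges, so the right side tends to 0, contradicting F_{a+1}(τ) >
0. -/
theorem one_le_of_besselSeries_le_rpow (ha : 0 < a) (hτ0 : 0 < τ) (hτ : besselSeries a τ = 0)
    (h : ∀ t, 0 ≤ t → t < τ → 0 < besselSeries a t) {ε : ℝ}
    (hε : ∀ t, 0 ≤ t → t < τ →
      besselSeries (a + 1) t ^ ((a + 1) / a) / besselSeries a t ≤ (τ / (τ - t)) ^ ε) :
    1 ≤ ε := by
  by_contra! hlt
  have ha1 : 0 < a + 1 := by positivity
  have p1τ := besselSeries_add_one_pos ha h hτ0.le le_rfl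
  have hslope := (hasDerivWithinAt_iff_tendsto_slope' (s := Set.Iio τ) (by simp)).1
    (hasDerivAt_besselSeries ha τ).hasDerivWithinAt
  have hpow : Filter.Tendsto (fun t : ℝ => (τ - t) ^ (1 - ε)) (nhdsWithin τ (Set.Iio τ))
      (nhds 0) := by
    have hc : Continuous fun t : ℝ => (τ - t) ^ (1 - ε) :=
      (Real.continuous_rpow_const (by linarith)).comp (continuous_const.sub continuous_id)
    have := hc.tendsto τ
    rw [sub_self, Real.zero_rpow (by linarith)] at this
    exact this.mono_left nhdsWithin_le_nhds
  have hright := (hslope.neg.mul hpow).const_mul (τ ^ ε)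
  rw [mul_zero, mul_zero] at hright
  have hleft : Filter.Tendsto (fun t => besselSeries (a + 1) t ^ ((a + 1) / a))
      (nhdsWithin τ (Set.Iio τ)) (nhds (besselSeries (a + 1) τ ^ ((a + 1) / a))) :=
    (((continuous_besselSeries ha1).tendsto τ).rpow_const (Or.inl p1τ.ne')).mono_left
      nhdsWithin_le_nhds
  have hle := le_of_tendsto_of_tendsto hleft hright (by
    filter_upwards [Ioo_mem_nhdsLT hτ0] with t ht
    have p0 := h t ht.1.le ht.2
    have hsub := sub_pos.2 ht.2
    have h1 := hε t ht.1.le ht.2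
    rw [div_le_iff₀ p0, Real.div_rpow hτ0.le hsub.le] at h1
    refine h1.trans_eq ?_
    rw [slope_def_field, hτ, Real.rpow_sub hsub, Real.rpow_one, ← neg_sub τ t]
    field_simp
    ring)
  exact absurd hle (not_le.2 (Real.rpow_pos_of_pos p1τ _))

end Bounds

/-! ### Return to the Bessel functions -/

theorem theorem3 (ν : ℝ) (hν : -1 < ν) :
    IsLeast (besselJPosZeros ν) (besselJFirstZero ν) ∧
    (∀ x : ℝ, |x| < besselJFirstZero ν →
      0 < normBesselJ ν x ∧ 0 < normBesselJ (ν + 1) x ∧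
      1 ≤ normBesselJ (ν + 1) x ^ ((ν + 2) / (ν + 1)) / normBesselJ ν x ∧
      normBesselJ (ν + 1) x ^ ((ν + 2) / (ν + 1)) / normBesselJ ν x ≤
        besselJFirstZero ν ^ 2 / (besselJFirstZero ν ^ 2 - x ^ 2)) ∧
    IsGreatest {ε : ℝ | ∀ x : ℝ, |x| < besselJFirstZero ν →
      (besselJFirstZero ν ^ 2 / (besselJFirstZero ν ^ 2 - x ^ 2)) ^ ε ≤
        normBesselJ (ν + 1) x ^ ((ν + 2) / (ν + 1)) / normBesselJ ν x} 0 ∧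
    IsLeast {ε : ℝ | ∀ x : ℝ, |x| < besselJFirstZero ν →
      normBesselJ (ν + 1) x ^ ((ν + 2) / (ν + 1)) / normBesselJ ν x ≤
        (besselJFirstZero ν ^ 2 / (besselJFirstZero ν ^ 2 - x ^ 2)) ^ ε} 1 := by
  have ha : 0 < ν + 1 := by linarith
  obtain ⟨τ, hτ0, hτ, hpos⟩ := exists_besselSeries_first_zero ha
  have hsq : (2 * √τ) ^ 2 = 4 * τ := by
    rw [mul_pow, Real.sq_sqrt hτ0.le]
    norm_num
  have hzero : ∀ x : ℝ, 0 < x → (besselJ ν x = 0 ↔ besselSeries (ν + 1) (x ^ 2 / 4) = 0) := by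
    intro x hx
    have hΓ := Real.Gamma_pos_of_pos ha
    have hc : 2 ^ ν * Real.Gamma (ν + 1) * x ^ (-ν) ≠ 0 := by positivity
    rw [← normBesselJ_eq_besselSeries, normBesselJ_eq_of_pos ν x hx, mul_eq_zero]
    simp [hc]
  have hleast : IsLeast (besselJPosZeros ν) (2 * √τ) := by
    refine ⟨⟨by positivity, ?_⟩, ?_⟩
    · rw [hzero _ (by positivity), hsq, mul_div_cancel_left₀ _ (by norm_num), hτ]
    · rintro x ⟨hx, hx0⟩
      rw [hzero x hx] at hx0
      by_contra! hlt
      have h1 : x ^ 2 < 4 * τ := hsq ▸ pow_lt_pow_left₀ hlt hx.le two_ne_zero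
      exact (hpos (x ^ 2 / 4) (by positivity) (by linarith)).ne' hx0
  have hj : besselJFirstZero ν = 2 * √τ := hleast.csInf_eq
  have hquot : ∀ x : ℝ, 4 * τ / (4 * τ - x ^ 2) = τ / (τ - x ^ 2 / 4) := by
    intro x
    rw [show 4 * τ - x ^ 2 = 4 * (τ - x ^ 2 / 4) by ring, mul_div_mul_left _ _ (by norm_num)]
  have hlt : ∀ x : ℝ, |x| < 2 * √τ → x ^ 2 / 4 < τ := by
    intro x hx
    have := pow_lt_pow_left₀ hx (abs_nonneg x) two_ne_zero
    rw [sq_abs, hsq] at this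
    linarith
  -- Each t in [0, τ) is x²/4 for x = 2√t, so a bound for all |x| < j transfers to all such t.
  have hpull : ∀ P : ℝ → Prop, (∀ x : ℝ, |x| < 2 * √τ → P (x ^ 2 / 4)) →
      ∀ t, 0 ≤ t → t < τ → P t := by
    intro P hP t ht0 ht
    have h1 := hP (2 * √t) (by
      rw [abs_of_nonneg (by positivity)]
      linarith [Real.sqrt_lt_sqrt ht0 ht])
    rwa [mul_pow, Real.sq_sqrt ht0, show (2 : ℝ) ^ 2 * t / 4 = t by ring] at h1
  have hexp : ν + 2 = ν + 1 + 1 := by ring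
  rw [hj, hsq, hexp]
  simp only [normBesselJ_eq_besselSeries, hquot]
  refine ⟨hleast, fun x hx => ?_, ⟨fun x hx => ?_, fun ε hε => ?_⟩,
    fun x hx => ?_, fun ε hε => ?_⟩
  · have h0 : 0 ≤ x ^ 2 / 4 := by positivity
    have h1 := hlt x hx
    exact ⟨hpos _ h0 h1, besselSeries_add_one_pos ha hpos h0 h1.le,
      one_le_besselSeries_rpow_div ha hpos h0 h1, besselSeries_rpow_div_le ha hτ hpos h0 h1⟩
  · rw [Real.rpow_zero]
    exact one_le_besselSeries_rpow_div ha hpos (by positivity) (hlt x hx)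
  · exact nonpos_of_rpow_le_besselSeries ha hτ0 hpos (hpull _ hε)
  · rw [Real.rpow_one]
    exact besselSeries_rpow_div_le ha hτ hpos (by positivity) (hlt x hx)
  · exact one_le_of_besselSeries_le_rpow ha hτ0 hτ hpos (hpull _ hε)
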